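/- Let $\mathbb{C}_+=\{z\in\mathbb{C}:\operatorname{Re} z>0\}$. Let $\tilde\nu$ be a positive regular Borel measure on $[0,\infty)$ with $\tilde\nu[0,r)>0$ for all $r>0$, satisfying the $\Delta_2$-condition $$\sup_{r>0}\frac{\tilde\nu[0,2r)}{\tilde\nu[0,r)}<\infty,$$ let $\lambda$ be Lebesgue measure on $i\mathbb{R}$, and put $\nu=\tilde\nu\otimes\lambda$, a measure on $\overline{\mathbb{C}_+}=[0,\infty)\times i\mathbb{R}$. The Zen space $A^2_\nu$ is the space of all analytic functions $F:\mathbb{C}_+\to\mathbb{C}$ with $$\|F\|_{A^2_\nu}^2:=\sup_{\varepsilon>0}\int_{\overline{\mathbb{C}_+}}|F(z+\varepsilon)|^2\,d\nu(z)<\infty .$$ Assume that the Laplace transform $f\mapsto\int_0^\infty f(t)e^{-t\,\cdot}\,dt$ from $L^2_w(0,\infty)$ to $A^2_\nu$ is surjective, where $w(t)=2\pi\int_{[0,\infty)}e^{-2rt}\,d\tilde\nu(r)$ and $L^2_w(0,\infty)$ is the $L^2$ space of the measure $w(t)\,dt$ on $(0,\infty)$. Then no composition operator on $A^2_\nu$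 is compact: for every analytic $\varphi:\mathbb{C}_+\to\mathbb{C}_+$, the operator $C_\varphi F=F\circ\varphi$ is not a compact operator $A^2_\nu\to A^2_\nu$. Moreover, whenever $C_\varphi$ is bounded on $A^2_\nu$, its essential norm, i.e. the distance in the operator norm from $C_\varphi$ to the set of compact operators on $A^2_\nu$, is positive. -/

import Mathlib

open MeasureTheory Set
open scoped NNReal ENNReal

noncomputable section

/-- The open right complex half-plane. -/
def rightHalfPlane : Set ℂ := {z : ℂ | 0 < z.re}

/-- The measures on `[0, ∞)` that define Zen spaces: regular Borel measures satisfying the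
`Δ₂`-condition `sup_{r > 0} μ[0, 2r) / μ[0, r) < ∞`, where, for the quotients to make sense, all
denominators are positive. (In `ℝ≥0`, the set `Set.Iio r` is `[0, r)`; regularity
includes finiteness on compact sets.) -/
class IsZenMeasure (μ : Measure ℝ≥0) : Prop where
  regular : μ.Regular
  pos : ∀ r : ℝ≥0, 0 < r → 0 < μ (Iio r)
  doubling : (⨆ (r : ℝ≥0) (_ : 0 < r), μ (Iio (2 * r)) / μ (Iio r)) < ⊤

attribute [instance] IsZenMeasure.regular

/-- The point `(x + ε) + i y`, i.e. the translate by `ε` of the point `x + i y` of the closed right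
half-plane `[0, ∞) × iℝ`. -/
def shiftPoint (ε : ℝ) (p : ℝ≥0 × ℝ) : ℂ := ⟨(p.1 : ℝ) + ε, p.2⟩

/-- The (extended) norm `(sup_{ε > 0} ∫ |F (z + ε)|² dν(z))^{1/2}` with `ν = μ ⊗ λ` on the closed
right half-plane, as the supremum of the `L²(ν)`-norms of the translates;
see `zenENorm_sq` for the squared form. -/
def zenENorm (μ : Measure ℝ≥0) (F : ℂ → ℂ) : ℝ≥0∞ :=
  ⨆ (ε : ℝ) (_ : 0 < ε), eLpNorm (fun p => F (shiftPoint ε p)) 2 (μ.prod volume)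

theorem zenENorm_sq (μ : Measure ℝ≥0) (F : ℂ → ℂ) :
    zenENorm μ F ^ 2 =
      ⨆ (ε : ℝ) (_ : 0 < ε), ∫⁻ p, ‖F (shiftPoint ε p)‖ₑ ^ 2 ∂(μ.prod volume) := by
  have key : ∀ ε : ℝ, eLpNorm (fun p => F (shiftPoint ε p)) 2 (μ.prod volume) ^ 2 =
      ∫⁻ p, ‖F (shiftPoint ε p)‖ₑ ^ 2 ∂(μ.prod volume) := fun ε => by
    have h := eLpNorm_nnreal_pow_eq_lintegral (μ := μ.prod volume)
      (f := fun p => F (shiftPoint ε p)) (p := 2) (by norm_num)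
    simpa using h
  have h := (ENNReal.orderIsoRpow 2 two_pos).map_iSup₂ (fun (ε : ℝ) (_ : 0 < ε) =>
    eLpNorm (fun p => F (shiftPoint ε p)) 2 (μ.prod volume))
  simp only [ENNReal.orderIsoRpow_apply, ENNReal.rpow_two, key] at h
  exact h

theorem shiftPoint_mem {ε : ℝ} (hε : 0 < ε) (p : ℝ≥0 × ℝ) : shiftPoint ε p ∈ rightHalfPlane :=
  add_pos_of_nonneg_of_pos p.1.2 hε

theorem continuous_shiftPoint (ε : ℝ) : Continuous (shiftPoint ε) := by
  have h : shiftPoint ε = fun p : ℝ≥0 × ℝ => (((p.1 : ℝ) + ε : ℝ) : ℂ) + (p.2 : ℂ) * Complex.I := by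
    funext p
    apply Complex.ext <;> simp [shiftPoint]
  rw [h]
  fun_prop

theorem continuous_comp_shiftPoint {F : ℂ → ℂ} (hF : DifferentiableOn ℂ F rightHalfPlane)
    {ε : ℝ} (hε : 0 < ε) : Continuous fun p => F (shiftPoint ε p) :=
  hF.continuousOn.comp_continuous (continuous_shiftPoint ε) (shiftPoint_mem hε)

theorem zenENorm_zero (μ : Measure ℝ≥0) : zenENorm μ 0 = 0 := by
  have h : (fun _ : ℝ≥0 × ℝ => (0 : ℂ)) = 0 := rfl
  simp [zenENorm, h]

theorem zenENorm_add_le (μ : Measure ℝ≥0) {F G : ℂ → ℂ}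
    (hF : DifferentiableOn ℂ F rightHalfPlane) (hG : DifferentiableOn ℂ G rightHalfPlane) :
    zenENorm μ (F + G) ≤ zenENorm μ F + zenENorm μ G := by
  refine iSup₂_le fun ε hε => ?_
  refine (eLpNorm_add_le (continuous_comp_shiftPoint hF hε).aestronglyMeasurable
    (continuous_comp_shiftPoint hG hε).aestronglyMeasurable (by norm_num)).trans ?_
  exact add_le_add
    (le_iSup₂ (f := fun (ε : ℝ) (_ : 0 < ε) =>
      eLpNorm (fun p => F (shiftPoint ε p)) 2 (μ.prod volume)) ε hε)
    (le_iSup₂ (f := fun (ε : ℝ) (_ : 0 < ε) =>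
      eLpNorm (fun p => G (shiftPoint ε p)) 2 (μ.prod volume)) ε hε)

theorem zenENorm_smul (μ : Measure ℝ≥0) (c : ℂ) (F : ℂ → ℂ) :
    zenENorm μ (c • F) = ‖c‖ₑ * zenENorm μ F := by
  unfold zenENorm
  simp only [ENNReal.mul_iSup]
  congr 1; funext ε; congr 1; funext _
  exact eLpNorm_const_smul c (fun p => F (shiftPoint ε p)) 2 _

/-- The Zen space as a subspace of all functions: an analytic function on the open
right half-plane is represented by its extension by zero to `ℂ`. -/
def zenSubmodule (μ : Measure ℝ≥0) : Submodule ℂ (ℂ → ℂ) where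
  carrier := {F | DifferentiableOn ℂ F rightHalfPlane ∧ (∀ z ∉ rightHalfPlane, F z = 0) ∧
    zenENorm μ F < ⊤}
  zero_mem' := ⟨differentiableOn_const 0, fun _ _ => rfl, by simp [zenENorm_zero]⟩
  add_mem' := fun {F G} hF hG => ⟨hF.1.add hG.1,
    fun z hz => by simp [hF.2.1 z hz, hG.2.1 z hz],
    (zenENorm_add_le μ hF.1 hG.1).trans_lt (ENNReal.add_lt_top.2 ⟨hF.2.2, hG.2.2⟩)⟩
  smul_mem' := fun c F hF => ⟨hF.1.const_smul c,
    fun z hz => by simp [hF.2.1 z hz],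
    by rw [zenENorm_smul]; exact ENNReal.mul_lt_top enorm_lt_top hF.2.2⟩

/-- The Zen space `A²_ν`, `ν = μ ⊗ λ`. It is a type of its own, so that its only topology is
the one of its norm (and not the topology of pointwise convergence). -/
def ZenSpace (μ : Measure ℝ≥0) : Type := zenSubmodule μ

instance (μ : Measure ℝ≥0) : AddCommGroup (ZenSpace μ) :=
  inferInstanceAs (AddCommGroup (zenSubmodule μ))

instance (μ : Measure ℝ≥0) : Module ℂ (ZenSpace μ) :=
  inferInstanceAs (Module ℂ (zenSubmodule μ))

instance (μ : Measure ℝ≥0) : CoeFun (ZenSpace μ) (fun _ => ℂ → ℂ) := ⟨fun F => F.1⟩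

/-- The norm of `A²_ν`. -/
instance (μ : Measure ℝ≥0) : Norm (ZenSpace μ) := ⟨fun F => (zenENorm μ F).toReal⟩

theorem ZenSpace.eq_zero_of_norm_eq_zero (μ : Measure ℝ≥0) [hμ : IsZenMeasure μ]
    (F : ZenSpace μ) (h : ‖F‖ = 0) : F = 0 := by
  obtain ⟨f, hd, ho, hfin⟩ := F
  have h0 : zenENorm μ f = 0 := by
    rcases (ENNReal.toReal_eq_zero_iff _).1 (show (zenENorm μ f).toReal = 0 from h) with h | h
    · exact h
    · exact absurd h hfin.ne
  have h1 : eLpNorm (fun p => f (shiftPoint 1 p)) 2 (μ.prod volume) = 0 :=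
    le_antisymm (h0 ▸ le_iSup₂ (f := fun (ε : ℝ) (_ : 0 < ε) =>
      eLpNorm (fun p => f (shiftPoint ε p)) 2 (μ.prod volume)) 1 one_pos) bot_le
  have hc := continuous_comp_shiftPoint hd one_pos
  rw [eLpNorm_eq_zero_iff hc.aestronglyMeasurable (by norm_num)] at h1
  have h2 := Measure.ae_ae_of_ae_prod h1
  have hne : μ ≠ 0 := fun h => by
    have := hμ.pos 1 one_pos
    simp [h] at this
  have : (ae μ).NeBot := ae_neBot.2 hne
  obtain ⟨x, hx⟩ := h2.exists
  have h3 : (fun y : ℝ => f (shiftPoint 1 (x, y))) = fun _ => 0 :=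
    Continuous.ae_eq_iff_eq volume (hc.comp (by fun_prop)) continuous_const |>.1 hx
  have hopen : IsOpen rightHalfPlane := isOpen_lt continuous_const Complex.continuous_re
  have hpre : IsPreconnected rightHalfPlane := (convex_halfSpace_re_gt 0).isPreconnected
  have hfreq : ∃ᶠ z in nhdsWithin (shiftPoint 1 (x, 0)) {shiftPoint 1 (x, 0)}ᶜ, f z = 0 := by
    have ht : Filter.Tendsto (fun y : ℝ => shiftPoint 1 (x, y)) (nhdsWithin 0 {0}ᶜ)
        (nhdsWithin (shiftPoint 1 (x, 0)) {shiftPoint 1 (x, 0)}ᶜ) := by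
      refine tendsto_nhdsWithin_of_tendsto_nhds_of_eventually_within _ ?_ ?_
      · exact (((continuous_shiftPoint 1).comp (by fun_prop :
          Continuous fun y : ℝ => ((x, y) : ℝ≥0 × ℝ))).tendsto 0).mono_left nhdsWithin_le_nhds
      · filter_upwards [self_mem_nhdsWithin] with y hy hcon
        exact hy (congrArg Complex.im hcon)
    exact ht.frequently (Filter.Frequently.of_forall fun y => congrFun h3 y)
  have h4 := (hd.analyticOnNhd hopen).eqOn_zero_of_preconnected_of_frequently_eq_zero hpre
    (shiftPoint_mem one_pos (x, 0)) hfreq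
  apply Subtype.ext
  funext z
  by_cases hz : z ∈ rightHalfPlane
  · exact h4 hz
  · exact ho z hz

instance (μ : Measure ℝ≥0) [IsZenMeasure μ] : NormedAddCommGroup (ZenSpace μ) :=
  AddGroupNorm.toNormedAddCommGroup
    { toFun := fun F => ‖F‖
      map_zero' := by
        change (zenENorm μ 0).toReal = 0
        simp [zenENorm_zero]
      add_le' := fun F G => by
        change (zenENorm μ (F.1 + G.1)).toReal ≤ (zenENorm μ F.1).toReal + (zenENorm μ G.1).toReal
        rw [← ENNReal.toReal_add F.2.2.2.ne G.2.2.2.ne]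
        exact ENNReal.toReal_mono (ENNReal.add_lt_top.2 ⟨F.2.2.2, G.2.2.2⟩).ne
          (zenENorm_add_le μ F.2.1 G.2.1)
      neg' := fun F => by
        change (zenENorm μ (-F.1)).toReal = (zenENorm μ F.1).toReal
        rw [← neg_one_smul ℂ F.1, zenENorm_smul]
        simp
      eq_zero_of_map_eq_zero' := fun F h => ZenSpace.eq_zero_of_norm_eq_zero μ F h }

instance (μ : Measure ℝ≥0) [IsZenMeasure μ] : NormedSpace ℂ (ZenSpace μ) where
  norm_smul_le c F := by
    change (zenENorm μ (c • F.1)).toReal ≤ ‖c‖ * (zenENorm μ F.1).toReal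
    rw [zenENorm_smul, ENNReal.toReal_mul, toReal_enorm]

/-- The weight `w(t) = 2π ∫_{[0, ∞)} e^{-2rt} dμ(r)`. -/
def zenWeight (μ : Measure ℝ≥0) (t : ℝ) : ℝ≥0∞ :=
  ENNReal.ofReal (2 * Real.pi) * ∫⁻ r : ℝ≥0, ENNReal.ofReal (Real.exp (-2 * r * t)) ∂μ

/-- The measure `w(t) dt` on `(0, ∞)`. -/
def zenWeightMeasure (μ : Measure ℝ≥0) : Measure ℝ :=
  (volume.restrict (Ioi 0)).withDensity (zenWeight μ)

/-- The Laplace transform `∫_0^∞ f(t) e^{-tz} dt`. -/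
def laplaceTransform (f : ℝ → ℂ) (z : ℂ) : ℂ :=
  ∫ t in Ioi (0 : ℝ), f t * Complex.exp (-(t * z))

/-- The Laplace transform from `L²_w(0, ∞)` to `A²_ν` is surjective. -/
def LaplaceSurjective (μ : Measure ℝ≥0) : Prop :=
  ∀ F : ZenSpace μ, ∃ f : ℝ → ℂ, MemLp f 2 (zenWeightMeasure μ) ∧
    ∀ z ∈ rightHalfPlane, F z = laplaceTransform f z

/-- The map `T` on `A²_ν` is the composition operator `C_φ`, i.e. `T F = F ∘ φ` on the right
half-plane for all `F`. In particular `C_φ` maps `A²_ν` into itself. -/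
def IsCompositionOperator {μ : Measure ℝ≥0} (φ : ℂ → ℂ) (T : ZenSpace μ → ZenSpace μ) : Prop :=
  ∀ F : ZenSpace μ, ∀ z ∈ rightHalfPlane, T F z = F (φ z)

/-- The essential norm: the distance in operator norm from the set of compact operators. -/
def essentialNorm {E : Type*} [NormedAddCommGroup E] [NormedSpace ℂ E] (T : E →L[ℂ] E) : ℝ :=
  Metric.infDist T {Q : E →L[ℂ] E | IsCompactOperator Q}

end

/-! ### Doubling -/

/-! Write `μ[0, r)` for `μ (Iio r)`. The proof tests operators against the scaled evaluations `ℓ_n F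
= (n μ[0, n))^{1/2} F(n)`, which have three properties.

They are uniformly bounded (`exists_norm_scaledEval_le`): average the sub-mean value property of
`|F|²` over the translates that enter the norm.

They tend to zero on each fixed `F` (`tendsto_norm_scaledEval`). By surjectivity `F` is the Laplace
transform of some `f` in `L²_w`. Since `w(t)` dominates `μ[0, 1/t)`, a Cauchy–Schwarz estimate
bounds `|ℓ_n F|²` by a constant times `∫ |f|² μ[0, 1/t) e^{-nt} dt`, which vanishes in the limit.

Composition with `C_φ` does not shrink them (`exists_le_norm_scaledEval`). The functional `ℓ_n ∘
C_φ` is a multiple of the evaluation at `φ(n)`, whose norm is at least a multiple of `(a μ[0,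
a))^{-1/2}` with `a = Re φ(n)`; the test functions `(z + w̄)^{-(p+1)}` show this. Schwarz–Pick gives
`a ≤ A n`, and doubling then compares `a μ[0, a)` with `n μ[0, n)`.

A compact `Q` maps the unit ball into a compact set, on which `ℓ_n → 0` uniformly. Hence `‖C_φ - Q‖`
is bounded below independently of `Q`. -/

theorem measure_Iio_lt_top (μ : Measure ℝ≥0) [IsZenMeasure μ] (r : ℝ≥0) : μ (Iio r) < ⊤ :=
  (measure_mono Iio_subset_Iic_self).trans_lt <| by
    rw [← Icc_bot]
    exact isCompact_Icc.measure_lt_top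

/-- Taking the doubling constant to be a power of two turns iterated doubling into polynomial growth
of order `p`, as `(2^p)^j = (2^j)^p`. -/
theorem exists_measure_Iio_two_mul_le (μ : Measure ℝ≥0) [hμ : IsZenMeasure μ] :
    ∃ p : ℕ, ∀ r : ℝ≥0, μ (Iio (2 * r)) ≤ 2 ^ p * μ (Iio r) := by
  obtain ⟨D, hD⟩ := WithTop.ne_top_iff_exists.1 hμ.doubling.ne
  obtain ⟨p, hp⟩ := pow_unbounded_of_one_lt D (one_lt_two (α := ℝ≥0))
  refine ⟨p, fun r => ?_⟩
  rcases eq_zero_or_pos r with rfl | hr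
  · simp
  have h1 : μ (Iio (2 * r)) / μ (Iio r) ≤ D := by
    exact (le_iSup₂ (f := fun (r : ℝ≥0) (_ : 0 < r) => μ (Iio (2 * r)) / μ (Iio r)) r hr).trans
      hD.ge
  rw [ENNReal.div_le_iff (hμ.pos r hr).ne' (measure_Iio_lt_top μ r).ne] at h1
  refine h1.trans ?_
  gcongr
  exact_mod_cast hp.le

theorem measure_Iio_two_pow_mul_le {μ : Measure ℝ≥0} {p : ℕ}
    (hp : ∀ r : ℝ≥0, μ (Iio (2 * r)) ≤ 2 ^ p * μ (Iio r)) (j : ℕ) (r : ℝ≥0) :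
    μ (Iio (2 ^ j * r)) ≤ (2 ^ p) ^ j * μ (Iio r) := by
  induction j with
  | zero => simp
  | succ j ih =>
    rw [pow_succ', mul_assoc]
    refine (hp _).trans ?_
    rw [pow_succ' _ j, mul_assoc]
    gcongr

theorem exists_two_pow_ge (s : ℝ≥0) : ∃ j : ℕ, s ≤ 2 ^ j ∧ (2 : ℝ≥0) ^ j ≤ 2 * (1 + s) := by
  rcases le_or_gt s 1 with h | h
  · exact ⟨0, by simpa using h, by
      rw [pow_zero, mul_add, mul_one]
      exact one_le_two.trans le_self_add⟩
  · obtain ⟨n, h1, h2⟩ := exists_nat_pow_near h.le (one_lt_two (α := ℝ≥0))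
    refine ⟨n + 1, h2.le, ?_⟩
    rw [pow_succ']
    gcongr
    exact h1.trans le_add_self

/-- Rounding `s` up to a power of two costs at most the factor `2 (1 + s)`, which also covers `s <
1`. -/
theorem measure_Iio_le_of_doubling {μ : Measure ℝ≥0} {p : ℕ}
    (hp : ∀ r : ℝ≥0, μ (Iio (2 * r)) ≤ 2 ^ p * μ (Iio r)) {r R s : ℝ≥0} (h : R ≤ s * r) :
    μ (Iio R) ≤ (2 * (1 + s : ℝ≥0)) ^ p * μ (Iio r) := by
  obtain ⟨j, h1, h2⟩ := exists_two_pow_ge s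
  calc μ (Iio R) ≤ μ (Iio (2 ^ j * r)) :=
        measure_mono (Iio_subset_Iio (h.trans (by gcongr)))
    _ ≤ (2 ^ p) ^ j * μ (Iio r) := measure_Iio_two_pow_mul_le hp j r
    _ = ((2 ^ j : ℝ≥0) : ℝ≥0∞) ^ p * μ (Iio r) := by
        rw [← pow_mul, mul_comm p j, pow_mul]; norm_cast
    _ ≤ _ := by
        gcongr
        exact_mod_cast h2

theorem measurable_measure_Iio (μ : Measure ℝ≥0) : Measurable fun r : ℝ≥0 => μ (Iio r) :=
  Monotone.measurable fun _ _ h => measure_mono (Iio_subset_Iio h)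

/-- A positive power of the kernel `1 / (r + a)` is integrable against a doubling measure, with
the expected bound. -/
theorem lintegral_inv_add_pow_le {μ : Measure ℝ≥0} {p : ℕ}
    (hp : ∀ r : ℝ≥0, μ (Iio (2 * r)) ≤ 2 ^ p * μ (Iio r)) {a : ℝ≥0} (ha : 0 < a) :
    ∫⁻ r : ℝ≥0, (((r + a) ^ (2 * p + 1))⁻¹ : ℝ≥0) ∂μ ≤
      2 ^ (2 * p + 2) * ((a ^ (2 * p + 1))⁻¹ : ℝ≥0) * μ (Iio a) := by
  set q := 2 * p + 1 with hq
  -- Dyadic decomposition: each `r` lies below some `2^j a ≤ 2 (r + a)`, so the `j`-th term alone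
  -- dominates the kernel.
  have key : ∀ r : ℝ≥0, ((((r + a) ^ q)⁻¹ : ℝ≥0) : ℝ≥0∞) ≤
      ∑' j : ℕ, (Iio (2 ^ j * a)).indicator
        (fun _ => 2 ^ q * (((2 ^ j * a) ^ q)⁻¹ : ℝ≥0) : ℝ≥0 → ℝ≥0∞) r := by
    intro r
    obtain ⟨j, h1, h2⟩ : ∃ j : ℕ, r < 2 ^ j * a ∧ 2 ^ j * a ≤ 2 * (r + a) := by
      rcases lt_or_ge r a with h | h
      · refine ⟨0, by simpa using h, ?_⟩
        rw [pow_zero, one_mul, two_mul, add_assoc]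
        exact le_add_of_nonneg_of_le (zero_le) (le_self_add)
      · obtain ⟨n, h1, h2⟩ := exists_nat_pow_near (x := r / a)
          ((one_le_div₀ ha).2 h) (one_lt_two (α := ℝ≥0))
        refine ⟨n + 1, (div_lt_iff₀ ha).1 h2, ?_⟩
        rw [pow_succ', mul_assoc]
        gcongr
        exact ((le_div_iff₀ ha).1 h1).trans le_self_add
    refine le_trans ?_ (ENNReal.le_tsum j)
    rw [indicator_of_mem (mem_Iio.2 h1)]
    have hpos : 0 < 2 ^ j * a := by positivity
    have : ((r + a) ^ q)⁻¹ ≤ 2 ^ q * ((2 ^ j * a) ^ q)⁻¹ := by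
      rw [← div_eq_mul_inv, inv_le_comm₀ (by positivity) (by positivity), inv_div,
        div_le_iff₀ (by positivity), ← mul_pow]
      exact pow_le_pow_left₀ zero_le (h2.trans_eq (mul_comm _ _)) q
    exact_mod_cast this
  refine (lintegral_mono key).trans ?_
  rw [lintegral_tsum fun j => (measurable_const.indicator measurableSet_Iio).aemeasurable]
  have hterm : ∀ j : ℕ, ∫⁻ r, (Iio (2 ^ j * a)).indicator
        (fun _ => 2 ^ q * (((2 ^ j * a) ^ q)⁻¹ : ℝ≥0) : ℝ≥0 → ℝ≥0∞) r ∂μ ≤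
      2 ^ q * ((a ^ q)⁻¹ : ℝ≥0) * μ (Iio a) * (2⁻¹) ^ j := by
    intro j
    rw [lintegral_indicator_const measurableSet_Iio]
    -- With `q = 2p + 1` the decay `2^{-qj}` beats the growth `2^{pj}` by at least `2^{-j}`, so the
    -- terms are summable.
    have h3 : (2 ^ p) ^ j * ((2 ^ j * a) ^ q)⁻¹ ≤ (a ^ q)⁻¹ * (2⁻¹ : ℝ≥0) ^ j := by
      rw [mul_pow, mul_inv, ← mul_assoc, mul_comm]
      gcongr
      rw [← div_eq_mul_inv, inv_pow, div_le_iff₀ (by positivity), ← pow_mul, ← pow_mul,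
        ← div_eq_inv_mul, le_div_iff₀ (by positivity), ← pow_add]
      refine pow_le_pow_right₀ one_le_two ?_
      rw [hq]; nlinarith
    calc _ ≤ 2 ^ q * (((2 ^ j * a) ^ q)⁻¹ : ℝ≥0) * ((2 ^ p) ^ j * μ (Iio a)) := by
          gcongr
          exact measure_Iio_two_pow_mul_le hp j a
      _ = 2 ^ q * (((2 ^ p) ^ j * ((2 ^ j * a) ^ q)⁻¹ : ℝ≥0) : ℝ≥0∞) * μ (Iio a) := by
          push_cast; ring
      _ ≤ 2 ^ q * ((a ^ q)⁻¹ * (2⁻¹ : ℝ≥0) ^ j : ℝ≥0) * μ (Iio a) := by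
          gcongr
      _ = _ := by
          rw [ENNReal.coe_mul, ENNReal.coe_pow, ENNReal.coe_inv two_ne_zero, ENNReal.coe_ofNat]
          ring
  refine (ENNReal.tsum_le_tsum hterm).trans_eq ?_
  rw [ENNReal.tsum_mul_left, ENNReal.tsum_geometric, ENNReal.one_sub_inv_two, inv_inv,
    show 2 * p + 2 = q + 1 from rfl, pow_succ]
  ring

/-! ### Schwarz–Pick -/

/-- The squared norms of denominator and numerator differ by `4 Re z Re w > 0`. -/
theorem rightHalfPlane_norm_div_sub_lt {z w : ℂ} (hz : z ∈ rightHalfPlane)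
    (hw : w ∈ rightHalfPlane) : ‖(z - w) / (z + (starRingEnd ℂ) w)‖ < 1 := by
  have hz : 0 < z.re := hz
  have hw : 0 < w.re := hw
  have h0 : z + (starRingEnd ℂ) w ≠ 0 := fun h => by
    have := congrArg Complex.re h
    simp at this; linarith
  rw [norm_div, div_lt_one (norm_pos_iff.2 h0), ← sq_lt_sq₀ (norm_nonneg _) (norm_nonneg _),
    ← Complex.normSq_eq_norm_sq, ← Complex.normSq_eq_norm_sq, Complex.normSq_apply,
    Complex.normSq_apply]
  simp
  nlinarith [mul_pos hz hw]

/-- Cayley maps sending `1` and `φ 1` to the origin turn `φ` into a self-map of the disc fixing `0`.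
The Schwarz lemma there, at the point `(x - 1) / (x + 1)` corresponding to `x`, limits the growth of
`Re φ` to linear. -/
theorem re_le_of_mapsTo_rightHalfPlane {φ : ℂ → ℂ} (hφ : DifferentiableOn ℂ φ rightHalfPlane)
    (hm : MapsTo φ rightHalfPlane rightHalfPlane) {x : ℝ} (hx : 1 ≤ x) :
    (φ x).re ≤ 4 * (φ 1).re * x := by
  have h1 : (1 : ℂ) ∈ rightHalfPlane := by simp [rightHalfPlane]
  have hxm : (x : ℂ) ∈ rightHalfPlane := by simp [rightHalfPlane]; linarith
  set c : ℂ → ℂ := fun ζ => (1 + ζ) / (1 - ζ) with hc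
  have hne : ∀ ζ ∈ Metric.ball (0 : ℂ) 1, 1 - ζ ≠ 0 := fun ζ hζ h => by
    rw [mem_ball_zero_iff, ← sub_eq_zero.1 h] at hζ
    simp at hζ
  have hcm : MapsTo c (Metric.ball 0 1) rightHalfPlane := fun ζ hζ => by
    have h2 : 0 < Complex.normSq (1 - ζ) := Complex.normSq_pos.2 (hne ζ hζ)
    rw [mem_ball_zero_iff] at hζ
    have h3 : Complex.normSq ζ < 1 := by
      rw [Complex.normSq_eq_norm_sq]
      exact pow_lt_one₀ (norm_nonneg _) hζ two_ne_zero
    rw [Complex.normSq_apply] at h3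
    change 0 < ((1 + ζ) / (1 - ζ)).re
    rw [Complex.div_re, ← add_div]
    refine div_pos ?_ h2
    simp
    nlinarith
  have hcd : DifferentiableOn ℂ c (Metric.ball 0 1) := fun ζ hζ =>
    (((differentiableAt_const _).add differentiableAt_id).div
      ((differentiableAt_const _).sub differentiableAt_id) (hne ζ hζ)).differentiableWithinAt
  set g : ℂ → ℂ := fun ζ => (φ (c ζ) - φ 1) / (φ (c ζ) + (starRingEnd ℂ) (φ 1)) with hg
  have hden : ∀ ζ ∈ Metric.ball (0 : ℂ) 1, φ (c ζ) + (starRingEnd ℂ) (φ 1) ≠ 0 :=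
    fun ζ hζ h => by
      have h2 : 0 < (φ (c ζ)).re := hm (hcm hζ)
      have h3 : 0 < (φ 1).re := hm h1
      have := congrArg Complex.re h
      simp at this; linarith
  have hφc : DifferentiableOn ℂ (fun ζ => φ (c ζ)) (Metric.ball 0 1) := hφ.comp hcd hcm
  have hgd : DifferentiableOn ℂ g (Metric.ball 0 1) :=
    (hφc.sub_const _).div (hφc.add_const _) hden
  have hgm : MapsTo g (Metric.ball 0 1) (Metric.closedBall 0 1) := fun ζ hζ =>
    mem_closedBall_zero_iff.2 (rightHalfPlane_norm_div_sub_lt (hm (hcm hζ)) (hm h1)).le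
  have hx0 : (x : ℂ) + 1 ≠ 0 := by
    exact_mod_cast (by linarith : x + 1 ≠ 0)
  set ζ : ℂ := (x - 1) / (x + 1) with hζ
  have hnζ : ‖ζ‖ = (x - 1) / (x + 1) := by
    have : ζ = (((x - 1) / (x + 1) : ℝ) : ℂ) := by simp [hζ]
    rw [this, Complex.norm_real, Real.norm_of_nonneg]
    exact div_nonneg (by linarith) (by linarith)
  have hcζ : c ζ = x := by
    simp only [hc, hζ]
    field_simp
    ring
  have h5 := Complex.norm_le_norm_of_mapsTo_ball hgd hgm (by simp [hg, hc])
    (z := ζ) (by rw [hnζ, div_lt_one (by linarith)]; linarith)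
  rw [hnζ] at h5
  simp only [hg, hcζ] at h5
  have hp : 0 < (φ x).re := hm hxm
  have hq : 0 < (φ 1).re := hm h1
  have hd : 0 < ‖φ x + (starRingEnd ℂ) (φ 1)‖ := norm_pos_iff.2 fun h => by
    have := congrArg Complex.re h
    simp at this; linarith
  rw [norm_div, div_le_div_iff₀ hd (by linarith)] at h5
  have h6 := pow_le_pow_left₀ (by positivity) h5 2
  rw [mul_pow, mul_pow, ← Complex.normSq_eq_norm_sq, ← Complex.normSq_eq_norm_sq,
    Complex.normSq_apply, Complex.normSq_apply] at h6
  simp at h6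
  generalize (φ x).re = p at *
  generalize (φ 1).re = q at *
  -- In `h6` the two squared norms differ by `4pq`, and `(x + 1)² - (x - 1)² = 4x`; the imaginary
  -- parts can then be dropped.
  have h7 : x * (p + q) ^ 2 ≤ p * q * (x + 1) ^ 2 := by
    nlinarith [mul_nonneg (by linarith : 0 ≤ x) (sq_nonneg ((φ x).im - (φ 1).im))]
  have h8 : x * p ^ 2 ≤ p * q * (4 * x ^ 2) := by
    have : (x + 1) ^ 2 ≤ 4 * x ^ 2 := by nlinarith
    have h9 := mul_le_mul_of_nonneg_left this (mul_pos hp hq).le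
    have : x * p ^ 2 ≤ x * (p + q) ^ 2 := by gcongr; linarith
    linarith
  have hxp : 0 < x * p := by positivity
  refine le_of_mul_le_mul_left ?_ hxp
  nlinarith

/-! ### Point evaluations -/

open Classical in
/-- The sub-mean value property of `|F|²` on discs. -/
theorem enorm_sq_mul_le_lintegral_ball {F : ℂ → ℂ} {c : ℂ} {R : ℝ} (hR : 0 < R)
    (hF : DifferentiableOn ℂ F (Metric.ball c R)) :
    ENNReal.ofReal (Real.pi * R ^ 2) * ‖F c‖ₑ ^ 2 ≤ ∫⁻ z in Metric.ball c R, ‖F z‖ₑ ^ 2 := by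
  have hcirc : ∀ ρ ∈ Ioo 0 R, ENNReal.ofReal (2 * Real.pi) * ‖F c‖ₑ ^ 2 ≤
      ∫⁻ θ in Ioo (-Real.pi) Real.pi, ‖F (circleMap c ρ θ)‖ₑ ^ 2 := by
    intro ρ hρ
    -- The mean value property is applied to the analytic function `F²`, which yields `|F|²`
    -- directly.
    have hd : DiffContOnCl ℂ (fun z => F z ^ 2) (Metric.ball c |ρ|) := by
      refine DifferentiableOn.diffContOnCl fun z hz => ?_
      have hz' : z ∈ Metric.ball c R := by
        have := Metric.closure_ball_subset_closedBall hz
        rw [abs_of_pos hρ.1, Metric.mem_closedBall] at this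
        exact Metric.mem_ball.2 (this.trans_lt hρ.2)
      exact (((hF z hz').differentiableAt (Metric.isOpen_ball.mem_nhds hz')).pow
        2).differentiableWithinAt
    have h := hd.circleAverage
    rw [Real.circleAverage_eq_integral_add (-Real.pi),
      intervalIntegral.integral_comp_add_right (fun θ => F (circleMap c ρ θ) ^ 2),
      show 0 + -Real.pi = -Real.pi by ring, show 2 * Real.pi + -Real.pi = Real.pi by ring,
      inv_smul_eq_iff₀ (by positivity)] at h
    rw [intervalIntegral.integral_of_le (by linarith [Real.pi_pos]),
      integral_Ioc_eq_integral_Ioo] at h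
    calc _ = ‖(2 * Real.pi) • F c ^ 2‖ₑ := by
          rw [enorm_smul, enorm_pow, Real.enorm_of_nonneg (by positivity)]
      _ ≤ _ := by
          rw [← h]
          refine (enorm_integral_le_lintegral_enorm _).trans_eq ?_
          simp only [enorm_pow]
  set B : ℂ → ℝ≥0∞ := (Metric.ball c R).indicator fun z => ‖F z‖ₑ ^ 2 with hB
  have hpol : ∫⁻ z in Metric.ball c R, ‖F z‖ₑ ^ 2 =
      ∫⁻ p in Complex.polarCoord.target, ENNReal.ofReal p.1 • B (c + Complex.polarCoord.symm p) := by
    refine Eq.trans ?_ (Complex.lintegral_comp_polarCoord_symm (fun z => B (c + z))).symm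
    rw [lintegral_add_left_eq_self B c, lintegral_indicator measurableSet_ball]
  have hBm : Measurable B := by
    have h1 : ContinuousOn (fun z => ‖F z‖ₑ ^ 2) (Metric.ball c R) :=
      (ENNReal.continuous_pow 2).comp_continuousOn hF.continuousOn.enorm
    have h2 := h1.measurable_piecewise (continuousOn_const (c := (0 : ℝ≥0∞))) measurableSet_ball
    rwa [show (fun _ : ℂ => (0 : ℝ≥0∞)) = 0 from rfl, piecewise_eq_indicator] at h2
  rw [hpol, Complex.polarCoord_target, Measure.volume_eq_prod, ← Measure.prod_restrict,
    lintegral_prod _ (by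
      simp only [Complex.polarCoord_symm_apply, smul_eq_mul]
      fun_prop)]
  calc _ = ∫⁻ ρ in Ioo 0 R, ENNReal.ofReal ρ * (ENNReal.ofReal (2 * Real.pi) * ‖F c‖ₑ ^ 2) := by
        rw [lintegral_mul_const _ (by fun_prop), ← mul_assoc]
        have h3 : ∫⁻ ρ in Ioo 0 R, ENNReal.ofReal ρ = ENNReal.ofReal (R ^ 2 / 2) := by
          have hi : IntegrableOn (fun ρ : ℝ => ρ) (Ioo 0 R) :=
            (continuous_id.integrableOn_Icc).mono_set Ioo_subset_Icc_self
          rw [← ofReal_integral_eq_lintegral_ofReal hi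
            ((ae_restrict_iff' measurableSet_Ioo).2 (ae_of_all _ fun ρ hρ => hρ.1.le)),
            ← integral_Ioc_eq_integral_Ioo, ← intervalIntegral.integral_of_le hR.le]
          simp
        rw [h3, ← ENNReal.ofReal_mul (by positivity)]
        congr 2
        ring
    _ ≤ ∫⁻ ρ in Ioo 0 R, ENNReal.ofReal ρ *
          ∫⁻ θ in Ioo (-Real.pi) Real.pi, ‖F (circleMap c ρ θ)‖ₑ ^ 2 :=
        setLIntegral_mono' measurableSet_Ioo fun ρ hρ => by
          gcongr
          exact hcirc ρ hρ
    _ = ∫⁻ ρ in Ioo 0 R, ∫⁻ θ in Ioo (-Real.pi) Real.pi,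
          ENNReal.ofReal ρ • B (c + Complex.polarCoord.symm (ρ, θ)) := by
        refine setLIntegral_congr_fun measurableSet_Ioo fun ρ hρ => ?_
        simp only [smul_eq_mul]
        rw [lintegral_const_mul' _ _ ENNReal.ofReal_ne_top]
        congr 1
        refine lintegral_congr fun θ => ?_
        have : c + Complex.polarCoord.symm (ρ, θ) = circleMap c ρ θ := by
          rw [Complex.polarCoord_symm_apply, circleMap, Complex.exp_mul_I]
          simp
        rw [this, hB, indicator_of_mem]
        rw [Metric.mem_ball, dist_eq_norm]
        simpa [circleMap, abs_of_pos hρ.1] using hρ.2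
    _ ≤ _ := lintegral_mono_set Ioo_subset_Ioi_self

theorem ZenSpace.lintegral_shiftPoint_le {μ : Measure ℝ≥0} (F : ZenSpace μ) {ε : ℝ} (hε : 0 < ε) :
    ∫⁻ p, ‖F (shiftPoint ε p)‖ₑ ^ 2 ∂(μ.prod volume) ≤ zenENorm μ F ^ 2 := by
  rw [zenENorm_sq]
  exact le_iSup₂ (f := fun (ε : ℝ) (_ : 0 < ε) =>
    ∫⁻ p, ‖F (shiftPoint ε p)‖ₑ ^ 2 ∂(μ.prod volume)) ε hε

theorem ZenSpace.measurable {μ : Measure ℝ≥0} (F : ZenSpace μ) : Measurable (F : ℂ → ℂ) := by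
  classical
  have ho : IsOpen rightHalfPlane := isOpen_lt continuous_const Complex.continuous_re
  have h := F.2.1.continuousOn.measurable_piecewise (continuousOn_const (c := (0 : ℂ)))
    ho.measurableSet
  convert h using 1
  funext z
  by_cases hz : z ∈ rightHalfPlane
  · simp [hz]
  · simp [hz, F.2.2.1 z hz]

/-- The norm controls `F` only on translates of `ν`, and `μ` may be singular. Integrating over `ε`
smooths `μ` into Lebesgue measure: the disc of radius `x/2` about `x` lies in a vertical strip that
is swept out by the points `r + ε`, for every `r < x/2`. -/
theorem ZenSpace.eval_le {μ : Measure ℝ≥0} [IsZenMeasure μ] (F : ZenSpace μ) {x : ℝ≥0}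
    (hx : 0 < x) :
    ENNReal.ofReal (Real.pi * (x / 2 : ℝ) ^ 2) * ‖F (x : ℝ)‖ₑ ^ 2 * μ (Iio (x / 2)) ≤
      ENNReal.ofReal (3 * x / 2) * zenENorm μ F ^ 2 := by
  have hxr : (0 : ℝ) < x := hx
  set g : ℝ → ℝ → ℝ≥0∞ := fun s y => ‖F ⟨s, y⟩‖ₑ ^ 2 with hg
  have hgm : Measurable (Function.uncurry g) := by
    have h1 : Measurable fun p : ℝ × ℝ => (⟨p.1, p.2⟩ : ℂ) :=
      Complex.measurableEquivRealProd.symm.measurable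
    exact ((F.measurable.comp h1).enorm).pow_const 2
  set H : ℝ → ℝ≥0∞ := fun s => ∫⁻ y, g s y with hH
  have hHm : Measurable H := hgm.lintegral_prod_right'
  set a : ℝ := x / 2 with ha
  set b : ℝ := 3 * x / 2 with hb
  have hsub : Metric.ball ((x : ℝ) : ℂ) a ⊆ rightHalfPlane := fun z hz => by
    have h1 := (Complex.abs_re_le_norm _).trans_lt (mem_ball_iff_norm.1 hz)
    rw [Complex.sub_re, Complex.ofReal_re, abs_lt] at h1
    change 0 < z.re
    linarith
  have hball : ∫⁻ z in Metric.ball ((x : ℝ) : ℂ) a, ‖F z‖ₑ ^ 2 ≤ ∫⁻ s in Ioo a b, H s := by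
    calc _ ≤ ∫⁻ z in Complex.re ⁻¹' Ioo a b, ‖F z‖ₑ ^ 2 := by
          refine lintegral_mono_set fun z hz => ?_
          have h1 := (Complex.abs_re_le_norm _).trans_lt (mem_ball_iff_norm.1 hz)
          rw [Complex.sub_re, Complex.ofReal_re, abs_lt] at h1
          exact ⟨by linarith, by linarith⟩
      _ = ∫⁻ p in Ioo a b ×ˢ univ, g p.1 p.2 := by
          rw [← Complex.volume_preserving_equiv_real_prod.symm.setLIntegral_comp_preimage_emb
            Complex.measurableEquivRealProd.symm.measurableEmbedding]
          congr 2
          ext p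
          simp [Complex.measurableEquivRealProd]
      _ = _ := by
          rw [Measure.volume_eq_prod, ← Measure.prod_restrict, Measure.restrict_univ]
          exact lintegral_prod _ hgm.aemeasurable
  -- Substitute `s = r + ε`; since `r < a`, every `s` in `(a, b)` comes from some `ε` in `(0, b)`.
  have hshift : ∀ r ∈ Iio (x / 2), ∫⁻ s in Ioo a b, H s ≤ ∫⁻ ε in Ioo 0 b, H (r + ε) := by
    intro r hr
    have hr' : (r : ℝ) < a := by
      have : (r : ℝ) < ((x / 2 : ℝ≥0) : ℝ) := NNReal.coe_lt_coe.2 hr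
      simpa using this
    rw [← lintegral_indicator measurableSet_Ioo, ← lintegral_indicator measurableSet_Ioo,
      ← lintegral_add_left_eq_self _ (r : ℝ)]
    refine lintegral_mono fun ε => ?_
    by_cases h : (r : ℝ) + ε ∈ Ioo a b
    · rw [indicator_of_mem h, indicator_of_mem]
      exact ⟨by linarith [h.1], by linarith [h.2, r.2]⟩
    · rw [indicator_of_notMem h]
      exact zero_le
  calc _ ≤ (∫⁻ s in Ioo a b, H s) * μ (Iio (x / 2)) := by
        gcongr
        exact (enorm_sq_mul_le_lintegral_ball (by positivity) (F.2.1.mono hsub)).trans hball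
    _ = ∫⁻ _r in Iio (x / 2), (∫⁻ s in Ioo a b, H s) ∂μ := by
        rw [setLIntegral_const]
    _ ≤ ∫⁻ r in Iio (x / 2), (∫⁻ ε in Ioo 0 b, H (r + ε)) ∂μ :=
        setLIntegral_mono' measurableSet_Iio hshift
    _ ≤ ∫⁻ r, (∫⁻ ε in Ioo 0 b, H (r + ε)) ∂μ := setLIntegral_le_lintegral _ _
    _ = ∫⁻ ε in Ioo 0 b, (∫⁻ r : ℝ≥0, H (r + ε) ∂μ) := by
        rw [lintegral_lintegral_swap]
        exact (hHm.comp (by fun_prop : Measurable fun p : ℝ≥0 × ℝ => (p.1 : ℝ) + p.2)).aemeasurable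
    _ ≤ ∫⁻ _ε in Ioo 0 b, zenENorm μ F ^ 2 := by
        refine setLIntegral_mono' measurableSet_Ioo fun ε hε => ?_
        refine le_trans (le_of_eq ?_) (F.lintegral_shiftPoint_le hε.1)
        exact (lintegral_prod _ (((F.measurable.comp
          (continuous_shiftPoint ε).measurable).enorm).pow_const 2).aemeasurable).symm
    _ = _ := by
        rw [setLIntegral_const, Real.volume_Ioo, sub_zero, mul_comm]

/-! ### The Laplace transform near infinity -/

/-- On `r < 1/t` the integrand of `w(t)` is at least `e^{-2}`, and `2π ≥ 1`. -/
theorem measure_Iio_le_zenWeight (μ : Measure ℝ≥0) {t : ℝ} (ht : 0 < t) :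
    μ (Iio t⁻¹.toNNReal) ≤ ENNReal.ofReal (Real.exp 2) * zenWeight μ t := by
  have h1 : ENNReal.ofReal (Real.exp (-2)) * μ (Iio t⁻¹.toNNReal) ≤
      ∫⁻ r : ℝ≥0, ENNReal.ofReal (Real.exp (-2 * r * t)) ∂μ := by
    rw [← setLIntegral_const]
    refine (setLIntegral_mono' measurableSet_Iio fun r hr => ?_).trans
      (setLIntegral_le_lintegral (Iio t⁻¹.toNNReal) _)
    refine ENNReal.ofReal_le_ofReal (Real.exp_le_exp.2 ?_)
    have h2 : (r : ℝ) < t⁻¹ := by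
      have := (Real.lt_toNNReal_iff_coe_lt).1 hr
      exact this
    have h3 : (r : ℝ) * t ≤ 1 := by
      rw [← inv_mul_cancel₀ ht.ne']
      gcongr
    linarith
  calc μ (Iio t⁻¹.toNNReal) =
      ENNReal.ofReal (Real.exp 2) * (1 * (ENNReal.ofReal (Real.exp (-2)) * μ (Iio t⁻¹.toNNReal))) := by
        rw [one_mul, ← mul_assoc, ← ENNReal.ofReal_mul (Real.exp_pos _).le, ← Real.exp_add]
        simp
    _ ≤ _ := by
        unfold zenWeight
        gcongr
        rw [ENNReal.one_le_ofReal]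
        linarith [Real.two_le_pi]

theorem measurable_zenWeight (μ : Measure ℝ≥0) [IsZenMeasure μ] : Measurable (zenWeight μ) := by
  unfold zenWeight
  refine Measurable.const_mul ?_ _
  exact Measurable.lintegral_prod_right'
    (f := fun p : ℝ × ℝ≥0 => ENNReal.ofReal (Real.exp (-2 * p.2 * p.1))) (by fun_prop)

theorem measurable_measure_Iio_inv (μ : Measure ℝ≥0) :
    Measurable fun t : ℝ => μ (Iio t⁻¹.toNNReal) :=
  (measurable_measure_Iio μ).comp (measurable_inv.real_toNNReal)

theorem measure_Iio_inv_pos (μ : Measure ℝ≥0) [hμ : IsZenMeasure μ] {t : ℝ} (ht : 0 < t) :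
    0 < μ (Iio t⁻¹.toNNReal) :=
  hμ.pos _ (Real.toNNReal_pos.2 (inv_pos.2 ht))

theorem zenWeight_pos (μ : Measure ℝ≥0) [hμ : IsZenMeasure μ] {t : ℝ} (ht : 0 < t) :
    0 < zenWeight μ t := by
  rw [pos_iff_ne_zero]
  intro h
  have := measure_Iio_le_zenWeight μ ht
  rw [h, mul_zero] at this
  exact (measure_Iio_inv_pos μ ht).not_ge this

theorem MeasureTheory.MemLp.aestronglyMeasurable_restrict_of_zenWeight {μ : Measure ℝ≥0}
    [hμ : IsZenMeasure μ] {f : ℝ → ℂ} (hf : MemLp f 2 (zenWeightMeasure μ)) :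
    AEStronglyMeasurable f (volume.restrict (Ioi 0)) :=
  hf.1.mono_ac <| withDensity_absolutelyContinuous' (measurable_zenWeight μ).aemeasurable <|
    (ae_restrict_iff' measurableSet_Ioi).2 (ae_of_all _ fun _ ht => (zenWeight_pos μ ht).ne')

theorem MeasureTheory.MemLp.lintegral_mul_measure_Iio_lt_top {μ : Measure ℝ≥0} [IsZenMeasure μ]
    {f : ℝ → ℂ} (hf : MemLp f 2 (zenWeightMeasure μ)) :
    ∫⁻ t in Ioi 0, ‖f t‖ₑ ^ 2 * μ (Iio t⁻¹.toNNReal) < ⊤ := by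
  have h1 := lintegral_rpow_enorm_lt_top_of_eLpNorm_lt_top two_ne_zero ENNReal.ofNat_ne_top hf.2
  rw [zenWeightMeasure, lintegral_withDensity_eq_lintegral_mul₀
    (measurable_zenWeight μ).aemeasurable
    (hf.aestronglyMeasurable_restrict_of_zenWeight.enorm.pow_const _)] at h1
  calc _ ≤ ∫⁻ t in Ioi 0, ENNReal.ofReal (Real.exp 2) *
        (zenWeight μ * fun a => ‖f a‖ₑ ^ (2 : ℝ≥0∞).toReal) t := by
        refine setLIntegral_mono' measurableSet_Ioi fun t ht => ?_
        rw [Pi.mul_apply, ← mul_assoc, mul_comm]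
        simp only [ENNReal.toReal_ofNat, ENNReal.rpow_ofNat]
        gcongr
        exact measure_Iio_le_zenWeight μ ht
    _ < ⊤ := by
        rw [lintegral_const_mul' _ _ ENNReal.ofReal_ne_top]
        exact ENNReal.mul_lt_top ENNReal.ofReal_lt_top h1

theorem sq_lintegral_mul_le {α : Type*} [MeasurableSpace α] (ν : Measure α) {f g : α → ℝ≥0∞}
    (hf : AEMeasurable f ν) (hg : AEMeasurable g ν) :
    (∫⁻ a, f a * g a ∂ν) ^ 2 ≤ (∫⁻ a, f a ^ 2 ∂ν) * ∫⁻ a, g a ^ 2 ∂ν := by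
  have h := ENNReal.lintegral_mul_le_Lp_mul_Lq ν Real.HolderConjugate.two_two hf hg
  have h2 := pow_le_pow_left₀ zero_le h 2
  simp only [Pi.mul_apply, ENNReal.rpow_ofNat] at h2
  refine h2.trans_eq ?_
  rw [mul_pow, ← ENNReal.rpow_natCast, ← ENNReal.rpow_natCast, ← ENNReal.rpow_mul,
    ← ENNReal.rpow_mul]
  norm_num

/-- A Cauchy–Schwarz estimate for the Laplace transform. -/
theorem enorm_laplaceTransform_sq_le (μ : Measure ℝ≥0) [IsZenMeasure μ] {f : ℝ → ℂ}
    (hf : MemLp f 2 (zenWeightMeasure μ)) (x : ℝ) :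
    ‖laplaceTransform f x‖ₑ ^ 2 ≤
      (∫⁻ t in Ioi 0, ‖f t‖ₑ ^ 2 * μ (Iio t⁻¹.toNNReal) * ENNReal.ofReal (Real.exp (-(x * t)))) *
      ∫⁻ t in Ioi 0, ENNReal.ofReal (Real.exp (-(x * t))) * (μ (Iio t⁻¹.toNNReal))⁻¹ := by
  set m : ℝ → ℝ≥0∞ := fun t => μ (Iio t⁻¹.toNNReal) with hm
  have hmm : Measurable m := measurable_measure_Iio_inv μ
  -- Half of the exponential goes to each Cauchy–Schwarz factor: the first then tends to zero as `x
  -- → ∞`, the second has size at most of order `1 / (x μ[0, x))`.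
  set h : ℝ → ℝ≥0∞ := fun t => (ENNReal.ofReal (Real.exp (-(x * t)))) ^ (1 / 2 : ℝ) with hh
  have hhm : Measurable h := by fun_prop
  have hsq : ∀ a : ℝ≥0∞, (a ^ (1 / 2 : ℝ)) ^ 2 = a := fun a => by
    rw [← ENNReal.rpow_natCast, ← ENNReal.rpow_mul]; norm_num
  have hfm := hf.aestronglyMeasurable_restrict_of_zenWeight.enorm
  have hCS := sq_lintegral_mul_le (volume.restrict (Ioi (0 : ℝ)))
    (f := fun t => ‖f t‖ₑ * m t ^ (1 / 2 : ℝ) * h t) (g := fun t => h t * (m t)⁻¹ ^ (1 / 2 : ℝ))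
    (by fun_prop) (by fun_prop)
  simp only [mul_pow, hsq, hh] at hCS
  refine le_trans ?_ hCS
  gcongr
  refine (enorm_integral_le_lintegral_enorm _).trans
    (setLIntegral_mono' measurableSet_Ioi fun t ht => ?_)
  have h0 : m t ^ (1 / 2 : ℝ) * (m t)⁻¹ ^ (1 / 2 : ℝ) = 1 := by
    rw [← ENNReal.mul_rpow_of_nonneg _ _ (by norm_num),
      ENNReal.mul_inv_cancel (measure_Iio_inv_pos μ ht).ne' (measure_Iio_lt_top μ _).ne,
      ENNReal.one_rpow]
  have h1 : ‖Complex.exp (-(t * x))‖ₑ = ENNReal.ofReal (Real.exp (-(x * t))) := by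
    rw [← ofReal_norm, Complex.norm_exp]
    simp [mul_comm]
  rw [enorm_mul, h1]
  calc _ = ‖f t‖ₑ * ((ENNReal.ofReal (Real.exp (-(x * t)))) ^ (1 / 2 : ℝ)) ^ 2 *
        (m t ^ (1 / 2 : ℝ) * (m t)⁻¹ ^ (1 / 2 : ℝ)) := by rw [h0, hsq, mul_one]
    _ ≤ _ := by
        refine le_of_eq ?_
        ring

theorem tendsto_lintegral_mul_exp {g : ℝ → ℝ≥0∞} (hg : AEMeasurable g (volume.restrict (Ioi 0)))
    (hfin : ∫⁻ t in Ioi 0, g t ≠ ⊤) :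
    Filter.Tendsto (fun n : ℕ => ∫⁻ t in Ioi 0, g t * ENNReal.ofReal (Real.exp (-((n : ℝ) * t))))
      Filter.atTop (nhds 0) := by
  have h := tendsto_lintegral_of_dominated_convergence'
    (μ := volume.restrict (Ioi (0 : ℝ)))
    (F := fun n t => g t * ENNReal.ofReal (Real.exp (-((n : ℝ) * t)))) (f := fun _ => 0) g
    (fun n => by fun_prop) (fun n => ?_) hfin ?_
  · simpa using h
  · refine (ae_restrict_iff' measurableSet_Ioi).2 (ae_of_all _ fun t (ht : 0 < t) => ?_)
    refine mul_le_of_le_one_right' ?_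
    rw [ENNReal.ofReal_le_one, Real.exp_le_one_iff]
    have : 0 ≤ (n : ℝ) * t := by positivity
    linarith
  · filter_upwards [ae_lt_top' hg hfin, ae_restrict_mem measurableSet_Ioi] with t h1 (ht : 0 < t)
    have h2 : Filter.Tendsto (fun n : ℕ => ENNReal.ofReal (Real.exp (-((n : ℝ) * t))))
        Filter.atTop (nhds 0) := by
      rw [← ENNReal.ofReal_zero]
      refine ENNReal.tendsto_ofReal (Real.tendsto_exp_neg_atTop_nhds_zero.comp ?_)
      exact tendsto_natCast_atTop_atTop.atTop_mul_const ht
    simpa using ENNReal.Tendsto.const_mul h2 (Or.inr h1.ne)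

/-- Doubling gives `μ[0, x) ≤ (2 (1 + xt))^p μ[0, 1/t)`. After the substitution `s = xt` the
integral is at most that of `(2 (1 + s))^p e^{-s}`, which does not depend on `x`. -/
theorem exists_lintegral_exp_mul_inv_le (μ : Measure ℝ≥0) [hμ : IsZenMeasure μ] :
    ∃ C : ℝ≥0, ∀ x : ℝ≥0, 0 < x →
      x * μ (Iio x) * ∫⁻ t in Ioi (0 : ℝ), ENNReal.ofReal (Real.exp (-((x : ℝ) * t))) *
        (μ (Iio t⁻¹.toNNReal))⁻¹ ≤ C := by
  obtain ⟨p, hp⟩ := exists_measure_Iio_two_mul_le μ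
  have hG : IntegrableOn (fun t : ℝ => (2 * (1 + t)) ^ p * Real.exp (-t)) (Ioi 0) := by
    refine integrable_of_isBigO_exp_neg (b := 1 / 2) (by norm_num) (by fun_prop)
      (Asymptotics.IsBigO.of_bound (4 ^ p * (p.factorial * Real.exp (1 / 2))) ?_)
    filter_upwards [Filter.eventually_ge_atTop 0] with t ht
    -- The polynomial is absorbed by `e^{(1+t)/2}`, which leaves the decay `e^{-t/2}`.
    have h1 := Real.pow_div_factorial_le_exp (x := (1 + t) / 2) (by positivity) p
    rw [div_le_iff₀ (by positivity)] at h1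
    rw [Real.norm_of_nonneg (by positivity), Real.norm_of_nonneg (by positivity)]
    calc (2 * (1 + t)) ^ p * Real.exp (-t) = 4 ^ p * ((1 + t) / 2) ^ p * Real.exp (-t) := by
          rw [← mul_pow]; ring_nf
      _ ≤ 4 ^ p * (Real.exp ((1 + t) / 2) * p.factorial) * Real.exp (-t) := by gcongr
      _ = 4 ^ p * p.factorial * (Real.exp ((1 + t) / 2) * Real.exp (-t)) := by ring
      _ = 4 ^ p * p.factorial * (Real.exp (1 / 2) * Real.exp (-(1 / 2) * t)) := by
          rw [← Real.exp_add, ← Real.exp_add]; ring_nf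
      _ = _ := by ring
  set J : ℝ → ℝ≥0∞ := fun s => ENNReal.ofReal ((2 * (1 + s)) ^ p * Real.exp (-s)) with hJ
  have hfin : ∫⁻ t in Ioi (0 : ℝ), J t ≠ ⊤ := hG.lintegral_lt_top.ne
  refine ⟨(∫⁻ t in Ioi (0 : ℝ), J t).toNNReal, fun x hx => ?_⟩
  rw [ENNReal.coe_toNNReal hfin]
  have hxr : (0 : ℝ) < x := hx
  have hmain : ∀ t ∈ Ioi (0 : ℝ), μ (Iio x) * (ENNReal.ofReal (Real.exp (-((x : ℝ) * t))) *
      (μ (Iio t⁻¹.toNNReal))⁻¹) ≤ J (x * t) := by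
    intro t (ht : 0 < t)
    have h1 : μ (Iio x) ≤ (2 * (1 + (x * t.toNNReal : ℝ≥0))) ^ p * μ (Iio t⁻¹.toNNReal) := by
      have := measure_Iio_le_of_doubling hp (r := t⁻¹.toNNReal) (R := x) (s := x * t.toNNReal) (by
        rw [mul_assoc, ← Real.toNNReal_mul ht.le, mul_inv_cancel₀ ht.ne']
        simp)
      exact_mod_cast this
    calc _ ≤ (2 * (1 + (x * t.toNNReal : ℝ≥0))) ^ p * μ (Iio t⁻¹.toNNReal) *
          (ENNReal.ofReal (Real.exp (-((x : ℝ) * t))) * (μ (Iio t⁻¹.toNNReal))⁻¹) := by gcongr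
      _ = (2 * (1 + (x * t.toNNReal : ℝ≥0))) ^ p * ENNReal.ofReal (Real.exp (-((x : ℝ) * t))) *
          (μ (Iio t⁻¹.toNNReal) * (μ (Iio t⁻¹.toNNReal))⁻¹) := by ring
      _ = _ := by
        rw [ENNReal.mul_inv_cancel (measure_Iio_inv_pos μ ht).ne' (measure_Iio_lt_top μ _).ne,
          mul_one, hJ]
        simp only
        rw [ENNReal.ofReal_mul (by positivity), ENNReal.ofReal_pow (by positivity),
          ENNReal.ofReal_mul (by positivity), ENNReal.ofReal_add one_pos.le (by positivity),
          ENNReal.ofReal_mul hxr.le]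
        simp [ENNReal.ofReal]
  calc _ = x * ∫⁻ t in Ioi (0 : ℝ), μ (Iio x) * (ENNReal.ofReal (Real.exp (-((x : ℝ) * t))) *
        (μ (Iio t⁻¹.toNNReal))⁻¹) := by
        rw [lintegral_const_mul' _ _ (measure_Iio_lt_top μ x).ne, mul_assoc]
    _ ≤ x * ∫⁻ t in Ioi (0 : ℝ), J (x * t) := by
        gcongr 1
        exact setLIntegral_mono' measurableSet_Ioi hmain
    _ = _ := by
        have hsc := Real.smul_map_volume_mul_left hxr.ne'
        have h3 : ∫⁻ s in Ioi (0 : ℝ), J s =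
            ∫⁻ s, (Ioi (0 : ℝ)).indicator J s
              ∂(ENNReal.ofReal |(x : ℝ)| • Measure.map ((x : ℝ) * ·) volume) := by
          rw [hsc, lintegral_indicator measurableSet_Ioi]
        have hJm : Measurable J := by fun_prop
        rw [h3, lintegral_smul_measure, lintegral_map (hJm.indicator measurableSet_Ioi)
          (by fun_prop), abs_of_pos hxr, ENNReal.ofReal_coe_nnreal, smul_eq_mul,
          ← lintegral_indicator measurableSet_Ioi]
        congr 2
        funext t
        simp [indicator, hxr]

/-- This is where surjectivity of the Laplace transform enters: the second Cauchy–Schwarz factor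
times `n μ[0, n)` stays bounded, and the first tends to zero. -/
theorem ZenSpace.tendsto_eval {μ : Measure ℝ≥0} [IsZenMeasure μ] (hL : LaplaceSurjective μ)
    (F : ZenSpace μ) :
    Filter.Tendsto (fun n : ℕ => n * μ (Iio (n : ℝ≥0)) * ‖F (n : ℝ)‖ₑ ^ 2)
      Filter.atTop (nhds 0) := by
  obtain ⟨f, hf, hF⟩ := hL F
  obtain ⟨C, hC⟩ := exists_lintegral_exp_mul_inv_le μ
  have h1 := tendsto_lintegral_mul_exp
    ((hf.aestronglyMeasurable_restrict_of_zenWeight.enorm.pow_const 2).mul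
      (measurable_measure_Iio_inv μ).aemeasurable) hf.lintegral_mul_measure_Iio_lt_top.ne
  have h2 := ENNReal.Tendsto.const_mul (a := (C : ℝ≥0∞)) h1 (Or.inr ENNReal.coe_ne_top)
  rw [mul_zero] at h2
  refine tendsto_of_tendsto_of_tendsto_of_le_of_le' tendsto_const_nhds h2
    (Filter.Eventually.of_forall fun _ => zero_le) ?_
  filter_upwards [Filter.eventually_gt_atTop 0] with n hn
  have hn' : (0 : ℝ) < n := by exact_mod_cast hn
  rw [hF _ (by simpa [rightHalfPlane] using hn)]
  refine (mul_le_mul_right (enorm_laplaceTransform_sq_le μ hf n) _).trans ?_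
  have h3 := hC n (by exact_mod_cast hn)
  simp only [NNReal.coe_natCast, ENNReal.coe_natCast] at h3
  rw [mul_comm (lintegral _ _), ← mul_assoc]
  exact mul_le_mul' h3 le_rfl

/-! ### Test functions -/

theorem lintegral_inv_sq_add_sq {A : ℝ} (hA : 0 < A) (b : ℝ) :
    ∫⁻ y : ℝ, ENNReal.ofReal (A ^ 2 + (y - b) ^ 2)⁻¹ = ENNReal.ofReal (Real.pi / A) := by
  rw [lintegral_sub_right_eq_self (fun y => ENNReal.ofReal (A ^ 2 + y ^ 2)⁻¹) b]
  have h1 : (fun y : ℝ => (A ^ 2 + y ^ 2)⁻¹) = fun y => (A ^ 2)⁻¹ * (1 + (y / A) ^ 2)⁻¹ := by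
    funext y
    rw [← mul_inv]
    congr 1
    field_simp
  have hi : Integrable fun y : ℝ => (A ^ 2 + y ^ 2)⁻¹ := by
    rw [h1]
    exact (integrable_inv_one_add_sq.comp_div hA.ne').const_mul _
  rw [← ofReal_integral_eq_lintegral_ofReal hi (ae_of_all _ fun y => by positivity), h1,
    integral_const_mul, Measure.integral_comp_div (fun y : ℝ => (1 + y ^ 2)⁻¹),
    integral_univ_inv_one_add_sq, abs_of_pos hA, smul_eq_mul]
  congr 1
  field_simp

open Classical in
/-- The function `(z + w̄)^{-k}` on the right half-plane, extended by zero. -/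
noncomputable def zenTest (k : ℕ) (w : ℂ) (z : ℂ) : ℂ :=
  if z ∈ rightHalfPlane then ((z + (starRingEnd ℂ) w) ^ k)⁻¹ else 0

theorem add_conj_ne_zero {z w : ℂ} (hz : z ∈ rightHalfPlane) (hw : w ∈ rightHalfPlane) :
    z + (starRingEnd ℂ) w ≠ 0 := fun h => by
  have h1 : 0 < z.re := hz
  have h2 : 0 < w.re := hw
  have := congrArg Complex.re h
  simp at this
  linarith

theorem differentiableOn_zenTest (k : ℕ) {w : ℂ} (hw : w ∈ rightHalfPlane) :
    DifferentiableOn ℂ (zenTest k w) rightHalfPlane := by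
  have h : DifferentiableOn ℂ (fun z => ((z + (starRingEnd ℂ) w) ^ k)⁻¹) rightHalfPlane :=
    DifferentiableOn.fun_inv (by fun_prop) fun z hz => pow_ne_zero k (add_conj_ne_zero hz hw)
  exact h.congr fun z hz => by rw [zenTest, if_pos hz]

/-- Dropping `ε` only increases the bound. One factor `|z + w̄|^{-2}` keeps its dependence on `y`,
to be integrated as a Poisson kernel; the other `p` are bounded by their values at `y = Im w`. -/
theorem enorm_zenTest_shiftPoint_sq_le (p : ℕ) {w : ℂ} (hw : w ∈ rightHalfPlane) {ε : ℝ}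
    (hε : 0 < ε) (r : ℝ≥0) (y : ℝ) :
    ‖zenTest (p + 1) w (shiftPoint ε (r, y))‖ₑ ^ 2 ≤
      ENNReal.ofReal (((r + w.re) ^ (2 * p))⁻¹) *
        ENNReal.ofReal ((r + w.re) ^ 2 + (y - w.im) ^ 2)⁻¹ := by
  have hw' : 0 < w.re := hw
  have h0 : 0 < r + w.re := add_pos_of_nonneg_of_pos r.2 hw'
  rw [zenTest, if_pos (shiftPoint_mem hε _), ← ofReal_norm, ← ENNReal.ofReal_pow (norm_nonneg _),
    ← ENNReal.ofReal_mul (by positivity), norm_inv, norm_pow, inv_pow, ← pow_mul, ← mul_inv,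
    mul_comm (p + 1) 2, pow_mul, ← Complex.normSq_eq_norm_sq, pow_mul _ 2 p]
  have h1 : (r + w.re) ^ 2 + (y - w.im) ^ 2 ≤
      Complex.normSq (shiftPoint ε (r, y) + (starRingEnd ℂ) w) := by
    rw [Complex.normSq_apply]
    simp only [shiftPoint, Complex.add_re, Complex.add_im, Complex.conj_re, Complex.conj_im]
    nlinarith
  refine ENNReal.ofReal_le_ofReal (inv_anti₀ (by positivity) ?_)
  rw [pow_succ]
  refine mul_le_mul (pow_le_pow_left₀ (by positivity) (le_trans ?_ h1) p) h1 (by positivity)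
    (pow_nonneg (Complex.normSq_nonneg _) p)
  nlinarith [sq_nonneg (y - w.im)]

/-- The integral over `y` is `π / (r + Re w)`, which leaves the power `2p + 1` that
`lintegral_inv_add_pow_le` handles. -/
theorem zenENorm_zenTest_sq_le {μ : Measure ℝ≥0} [IsZenMeasure μ] {p : ℕ}
    (hp : ∀ r : ℝ≥0, μ (Iio (2 * r)) ≤ 2 ^ p * μ (Iio r)) {w : ℂ} (hw : w ∈ rightHalfPlane) :
    zenENorm μ (zenTest (p + 1) w) ^ 2 ≤ ENNReal.ofReal Real.pi *
      (2 ^ (2 * p + 2) * ((w.re.toNNReal ^ (2 * p + 1))⁻¹ : ℝ≥0) * μ (Iio w.re.toNNReal)) := by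
  have hw' : 0 < w.re := hw
  rw [zenENorm_sq]
  refine iSup₂_le fun ε hε => ?_
  rw [lintegral_prod _ (((continuous_comp_shiftPoint (differentiableOn_zenTest (p + 1) hw)
    hε).measurable.enorm.pow_const 2).aemeasurable)]
  calc _ ≤ ∫⁻ r : ℝ≥0, ENNReal.ofReal Real.pi *
        (((r + w.re.toNNReal) ^ (2 * p + 1))⁻¹ : ℝ≥0) ∂μ := by
        refine lintegral_mono fun r => ?_
        have h0 : 0 < r + w.re := add_pos_of_nonneg_of_pos r.2 hw'
        refine (lintegral_mono fun y => enorm_zenTest_shiftPoint_sq_le p hw hε r y).trans_eq ?_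
        rw [lintegral_const_mul' _ _ ENNReal.ofReal_ne_top, lintegral_inv_sq_add_sq h0,
          ← ENNReal.ofReal_coe_nnreal, ← ENNReal.ofReal_mul (by positivity),
          ← ENNReal.ofReal_mul (by positivity)]
        congr 1
        push_cast
        rw [Real.coe_toNNReal _ hw'.le, pow_succ]
        field_simp
    _ ≤ _ := by
        rw [lintegral_const_mul' _ _ ENNReal.ofReal_ne_top]
        gcongr
        exact lintegral_inv_add_pow_le hp (Real.toNNReal_pos.2 hw')

/-- The norm of the evaluation at `w` is at least a multiple of `(Re w · μ[0, Re w))^{-1/2}`. -/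
theorem exists_zenENorm_sq_le_mul_eval (μ : Measure ℝ≥0) [IsZenMeasure μ] :
    ∃ C : ℝ≥0, ∀ w ∈ rightHalfPlane, ∃ G : ZenSpace μ, G w ≠ 0 ∧
      zenENorm μ G ^ 2 ≤ C * (w.re.toNNReal * μ (Iio w.re.toNNReal)) * ‖G w‖ₑ ^ 2 := by
  obtain ⟨p, hp⟩ := exists_measure_Iio_two_mul_le μ
  -- One factor `2^{2p+2}` comes from the norm estimate, the other from `|G w|² = (2 Re
  -- w)^{-(2p+2)}`.
  refine ⟨Real.pi.toNNReal * 2 ^ (4 * p + 4), fun w hw => ?_⟩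
  have hw' : 0 < w.re := hw
  have hle := zenENorm_zenTest_sq_le hp hw
  have hfin : zenENorm μ (zenTest (p + 1) w) < ⊤ := by
    refine (ENNReal.pow_lt_top_iff.1 (?_ : _ ^ 2 < ⊤)).resolve_right two_ne_zero
    refine hle.trans_lt (ENNReal.mul_lt_top ENNReal.ofReal_lt_top (ENNReal.mul_lt_top
      (ENNReal.mul_lt_top (by finiteness) ENNReal.coe_lt_top) (measure_Iio_lt_top μ _)))
  refine ⟨⟨zenTest (p + 1) w, differentiableOn_zenTest _ hw, fun z hz => if_neg hz, hfin⟩, ?_, ?_⟩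
  · change zenTest (p + 1) w w ≠ 0
    rw [zenTest, if_pos hw]
    exact inv_ne_zero (pow_ne_zero _ (add_conj_ne_zero hw hw))
  · change zenENorm μ (zenTest (p + 1) w) ^ 2 ≤ _ * ‖zenTest (p + 1) w w‖ₑ ^ 2
    refine hle.trans_eq ?_
    have h1 : ‖zenTest (p + 1) w w‖ₑ ^ 2 = (((2 * w.re.toNNReal) ^ (2 * p + 2))⁻¹ : ℝ≥0) := by
      rw [zenTest, if_pos hw, Complex.add_conj, ← ofReal_norm, ← ENNReal.ofReal_pow (norm_nonneg _),
        norm_inv, norm_pow, Complex.norm_real, Real.norm_of_nonneg (by positivity), inv_pow,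
        ← pow_mul, ENNReal.ofReal]
      congr 1
      rw [← NNReal.coe_inj, Real.coe_toNNReal _ (by positivity)]
      push_cast
      rw [Real.coe_toNNReal _ hw'.le]
      ring_nf
    rw [h1, ENNReal.ofReal]
    generalize hm : μ (Iio w.re.toNNReal) = m
    have ha : 0 < w.re.toNNReal := Real.toNNReal_pos.2 hw'
    generalize w.re.toNNReal = a at ha
    generalize Real.pi.toNNReal = c
    have h2 : c * 2 ^ (2 * p + 2) * (a ^ (2 * p + 1))⁻¹ =
        c * 2 ^ (4 * p + 4) * a * ((2 * a) ^ (2 * p + 2))⁻¹ := by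
      field_simp
      ring
    have h3 := congrArg (fun t : ℝ≥0 => (t : ℝ≥0∞) * m) h2
    simp only [ENNReal.coe_mul, ENNReal.coe_pow, ENNReal.coe_ofNat] at h3
    calc _ = _ := by ring
      _ = _ := h3
      _ = _ := by push_cast; ring

/-! ### The essential norm -/

theorem exists_eval_sq_le (μ : Measure ℝ≥0) [IsZenMeasure μ] :
    ∃ C : ℝ≥0, ∀ (F : ZenSpace μ) (x : ℝ≥0), 0 < x →
      x * μ (Iio x) * ‖F (x : ℝ)‖ₑ ^ 2 ≤ C * zenENorm μ F ^ 2 := by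
  obtain ⟨p, hp⟩ := exists_measure_Iio_two_mul_le μ
  refine ⟨2 ^ p * 2, fun F x hx => ?_⟩
  have hxr : (0 : ℝ) < x := hx
  have h1 := F.eval_le hx
  have h2 := hp (x / 2)
  rw [mul_div_cancel₀ _ two_ne_zero] at h2
  -- The disc has at least the area `(3x/2)(x/2)`, because `π > 3`.
  have h3 : ENNReal.ofReal (3 * x / 2) * ENNReal.ofReal (x / 2) ≤
      ENNReal.ofReal (Real.pi * (x / 2 : ℝ) ^ 2) := by
    rw [← ENNReal.ofReal_mul (by positivity)]
    refine ENNReal.ofReal_le_ofReal ?_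
    have h4 := mul_le_mul_of_nonneg_right Real.pi_gt_three.le (sq_nonneg (x / 2 : ℝ))
    linarith
  have h5 : ENNReal.ofReal (x / 2) * ‖F (x : ℝ)‖ₑ ^ 2 * μ (Iio (x / 2)) ≤ zenENorm μ F ^ 2 := by
    rw [← ENNReal.mul_le_mul_iff_right (a := ENNReal.ofReal (3 * x / 2))
      (ENNReal.ofReal_pos.2 (by positivity)).ne' ENNReal.ofReal_ne_top]
    refine le_trans ?_ h1
    rw [← mul_assoc, ← mul_assoc]
    gcongr
  have h6 : (x : ℝ≥0∞) = 2 * ENNReal.ofReal (x / 2) := by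
    rw [← ENNReal.ofReal_ofNat, ← ENNReal.ofReal_mul two_pos.le, mul_div_cancel₀ _ two_ne_zero,
      ENNReal.ofReal_coe_nnreal]
  calc (x : ℝ≥0∞) * μ (Iio x) * ‖F (x : ℝ)‖ₑ ^ 2
      ≤ x * (2 ^ p * μ (Iio (x / 2))) * ‖F (x : ℝ)‖ₑ ^ 2 := by gcongr
    _ = 2 ^ p * 2 * (ENNReal.ofReal (x / 2) * ‖F (x : ℝ)‖ₑ ^ 2 * μ (Iio (x / 2))) := by
        rw [h6]; ring
    _ ≤ _ := by
        push_cast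
        gcongr

/-- An operator whose adjoint does not shrink a bounded, weak-* null sequence of functionals has
distance bounded from below to every compact operator. -/
theorem le_mul_norm_sub_of_isCompactOperator {E : Type*} [NormedAddCommGroup E] [NormedSpace ℂ E]
    {ℓ : ℕ → E →ₗ[ℂ] ℂ} {C c : ℝ} (hC0 : 0 ≤ C)
    (hC : ∀ᶠ n in Filter.atTop, ∀ F, ‖ℓ n F‖ ≤ C * ‖F‖)
    (h0 : ∀ F, Filter.Tendsto (fun n => ‖ℓ n F‖) Filter.atTop (nhds 0)) {T Q : E →L[ℂ] E}
    (hT : ∀ᶠ n in Filter.atTop, ∃ G, G ≠ 0 ∧ c * ‖G‖ ≤ ‖ℓ n (T G)‖) (hQ : IsCompactOperator Q) :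
    c ≤ C * ‖T - Q‖ := by
  refine le_of_forall_pos_le_add fun ε hε => ?_
  obtain ⟨K, hK, hQK⟩ := IsCompactOperator.image_closedBall_subset_compact
    (f := (Q : E →ₗ[ℂ] E)) hQ 1
  -- A finite net of this mesh makes the pointwise convergence of `ℓ` uniform on `K` up to `ε`; `C +
  -- 1` avoids division by zero.
  have hδ : 0 < ε / (2 * (C + 1)) := by positivity
  obtain ⟨t, -, htf, hcov⟩ := hK.finite_cover_balls hδ
  have hev : ∀ᶠ n in Filter.atTop, ∀ F ∈ t, ‖ℓ n F‖ < ε / 2 :=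
    (htf.eventually_all (p := fun F n => ‖ℓ n F‖ < ε / 2)).2 fun F _ =>
      (h0 F).eventually_lt_const (by positivity)
  obtain ⟨n, h1, h2, G, hG0, hG⟩ := (hC.and (hev.and hT)).exists
  have hGpos : 0 < ‖G‖ := norm_pos_iff.2 hG0
  have hunit : ∀ F, ‖F‖ ≤ 1 → ‖ℓ n (Q F)‖ ≤ ε := fun F hF => by
    have hm := hcov (hQK ⟨F, mem_closedBall_zero_iff.2 hF, rfl⟩)
    simp only [mem_iUnion] at hm
    obtain ⟨y, hy, hFy⟩ := hm
    have h3 : ‖Q F - y‖ ≤ ε / (2 * (C + 1)) := (mem_ball_iff_norm.1 hFy).le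
    calc ‖ℓ n (Q F)‖ = ‖ℓ n (Q F - y) + ℓ n y‖ := by rw [map_sub, sub_add_cancel]
      _ ≤ ‖ℓ n (Q F - y)‖ + ‖ℓ n y‖ := norm_add_le _ _
      _ ≤ C * (ε / (2 * (C + 1))) + ε / 2 := by
          gcongr
          · exact (h1 _).trans (by gcongr)
          · exact (h2 y hy).le
      _ ≤ (C + 1) * (ε / (2 * (C + 1))) + ε / 2 := by gcongr; linarith
      _ = ε := by field_simp; ring
  have hQG : ‖ℓ n (Q G)‖ ≤ ε * ‖G‖ := by
    have h4 := hunit ((‖G‖ : ℂ)⁻¹ • G) (by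
      rw [norm_smul, norm_inv, Complex.norm_real, norm_norm, inv_mul_cancel₀ hGpos.ne'])
    rwa [map_smul, map_smul, norm_smul, norm_inv, Complex.norm_real, norm_norm,
      inv_mul_le_iff₀ hGpos, mul_comm] at h4
  refine le_of_mul_le_mul_right ?_ hGpos
  calc c * ‖G‖ ≤ ‖ℓ n (T G)‖ := hG
    _ = ‖ℓ n ((T - Q) G) + ℓ n (Q G)‖ := by
        rw [← map_add]; simp
    _ ≤ ‖ℓ n ((T - Q) G)‖ + ‖ℓ n (Q G)‖ := norm_add_le _ _
    _ ≤ C * (‖T - Q‖ * ‖G‖) + ε * ‖G‖ := by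
        gcongr
        exact (h1 _).trans (by gcongr; exact (T - Q).le_opNorm G)
    _ = _ := by ring

/-- The evaluation at `n`, multiplied by `(n μ[0, n))^{1/2}`. -/
noncomputable def scaledEval (μ : Measure ℝ≥0) (n : ℕ) : ZenSpace μ →ₗ[ℂ] ℂ where
  toFun F := (√(n * μ (Iio (n : ℝ≥0))).toReal : ℂ) * F (n : ℝ)
  map_add' _ _ := mul_add _ _ _
  map_smul' _ _ := mul_left_comm _ _ _

theorem norm_scaledEval_sq {μ : Measure ℝ≥0} (n : ℕ) (F : ZenSpace μ) :
    ‖scaledEval μ n F‖ ^ 2 = (n * μ (Iio (n : ℝ≥0)) * ‖F (n : ℝ)‖ₑ ^ 2).toReal := by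
  change ‖(√(n * μ (Iio (n : ℝ≥0))).toReal : ℂ) * F (n : ℝ)‖ ^ 2 = _
  rw [norm_mul, mul_pow, Complex.norm_real, Real.norm_of_nonneg (Real.sqrt_nonneg _),
    Real.sq_sqrt ENNReal.toReal_nonneg, ENNReal.toReal_mul (b := ‖F (n : ℝ)‖ₑ ^ 2),
    ENNReal.toReal_pow, toReal_enorm]

theorem ZenSpace.norm_sq {μ : Measure ℝ≥0} [IsZenMeasure μ] (F : ZenSpace μ) :
    ‖F‖ ^ 2 = (zenENorm μ F ^ 2).toReal :=
  (ENNReal.toReal_pow _ _).symm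

theorem exists_norm_scaledEval_le (μ : Measure ℝ≥0) [IsZenMeasure μ] :
    ∃ C : ℝ, 0 < C ∧ ∀ᶠ n in Filter.atTop, ∀ F, ‖scaledEval μ n F‖ ≤ C * ‖F‖ := by
  obtain ⟨C, hC⟩ := exists_eval_sq_le μ
  refine ⟨√(C + 1), by positivity, ?_⟩
  filter_upwards [Filter.eventually_gt_atTop 0] with n hn F
  have h1 := hC F n (by exact_mod_cast hn)
  simp only [NNReal.coe_natCast, ENNReal.coe_natCast] at h1
  have h2 := ENNReal.toReal_mono
    (ENNReal.mul_ne_top ENNReal.coe_ne_top (ENNReal.pow_ne_top F.2.2.2.ne)) h1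
  rw [← norm_scaledEval_sq, ENNReal.toReal_mul, ← ZenSpace.norm_sq] at h2
  refine le_of_sq_le_sq ?_ (by positivity)
  rw [mul_pow, Real.sq_sqrt (by positivity)]
  refine h2.trans ?_
  gcongr
  simp

theorem tendsto_norm_scaledEval {μ : Measure ℝ≥0} [IsZenMeasure μ] (hL : LaplaceSurjective μ)
    (F : ZenSpace μ) :
    Filter.Tendsto (fun n => ‖scaledEval μ n F‖) Filter.atTop (nhds 0) := by
  have h1 := (ENNReal.tendsto_toReal ENNReal.zero_ne_top).comp (ZenSpace.tendsto_eval hL F)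
  have h2 := (Real.continuous_sqrt.tendsto _).comp h1
  simp only [ENNReal.toReal_zero, Real.sqrt_zero] at h2
  refine h2.congr fun n => ?_
  simp only [Function.comp_apply]
  rw [← norm_scaledEval_sq, Real.sqrt_sq (norm_nonneg _)]

/-- The witness is the test function at `w = φ(n)`. The position of `Im φ(n)` is irrelevant, since
the bound of `exists_zenENorm_sq_le_mul_eval` depends on `w` only through `Re w` and `|G w|`. -/
theorem exists_le_norm_scaledEval {μ : Measure ℝ≥0} [IsZenMeasure μ] {φ : ℂ → ℂ}
    (hφ : DifferentiableOn ℂ φ rightHalfPlane)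
    (hm : MapsTo φ rightHalfPlane rightHalfPlane) {T : ZenSpace μ → ZenSpace μ}
    (hT : IsCompositionOperator φ T) :
    ∃ c : ℝ, 0 < c ∧ ∀ᶠ n in Filter.atTop, ∃ G, G ≠ 0 ∧ c * ‖G‖ ≤ ‖scaledEval μ n (T G)‖ := by
  obtain ⟨p, hp⟩ := exists_measure_Iio_two_mul_le μ
  obtain ⟨C, hC⟩ := exists_zenENorm_sq_le_mul_eval μ
  set A : ℝ≥0 := (4 * (φ 1).re).toNNReal with hA
  set D : ℝ≥0 := C * (A * (2 * (1 + A)) ^ p) with hD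
  refine ⟨(√(D + 1))⁻¹, by positivity, ?_⟩
  filter_upwards [Filter.eventually_ge_atTop 1] with n hn
  have hn1 : (1 : ℝ) ≤ n := by exact_mod_cast hn
  have hnm : ((n : ℝ) : ℂ) ∈ rightHalfPlane := by
    change 0 < ((n : ℝ) : ℂ).re
    rw [Complex.ofReal_re]; linarith
  obtain ⟨G, hG0, hG⟩ := hC _ (hm hnm)
  refine ⟨G, fun h => hG0 (by rw [h]; rfl), ?_⟩
  have ha : (φ (n : ℝ)).re.toNNReal ≤ A * n := by
    have h1' : (1 : ℂ) ∈ rightHalfPlane := by simp [rightHalfPlane]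
    have h1 := Real.toNNReal_le_toNNReal (re_le_of_mapsTo_rightHalfPlane hφ hm hn1)
    rwa [Real.toNNReal_mul (mul_nonneg four_pos.le (hm h1').le), Real.toNNReal_natCast] at h1
  have hb := measure_Iio_le_of_doubling hp ha
  have h2 : zenENorm μ G ^ 2 ≤ D * (n * μ (Iio (n : ℝ≥0)) * ‖T G (n : ℝ)‖ₑ ^ 2) := by
    rw [hT G _ hnm]
    calc _ ≤ _ := hG
      _ ≤ C * ((A * n : ℝ≥0) * ((2 * (1 + A : ℝ≥0)) ^ p * μ (Iio (n : ℝ≥0)))) *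
          ‖G (φ (n : ℝ))‖ₑ ^ 2 := by gcongr
      _ = _ := by
          rw [hD]; push_cast; ring
  have h3 := ENNReal.toReal_mono (by
    refine ENNReal.mul_ne_top ENNReal.coe_ne_top (ENNReal.mul_ne_top (ENNReal.mul_ne_top
      (ENNReal.natCast_ne_top n) (measure_Iio_lt_top μ _).ne) (by finiteness))) h2
  rw [ENNReal.toReal_mul, ← norm_scaledEval_sq, ← ZenSpace.norm_sq] at h3
  rw [inv_mul_le_iff₀ (by positivity)]
  refine le_of_sq_le_sq ?_ (by positivity)
  rw [mul_pow, Real.sq_sqrt (by positivity)]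
  refine h3.trans ?_
  gcongr
  simp

theorem IsCompositionOperator.essentialNorm_pos {μ : Measure ℝ≥0} [IsZenMeasure μ]
    (hL : LaplaceSurjective μ) {φ : ℂ → ℂ} (hφ : DifferentiableOn ℂ φ rightHalfPlane)
    (hm : MapsTo φ rightHalfPlane rightHalfPlane) {T : ZenSpace μ →L[ℂ] ZenSpace μ}
    (hT : IsCompositionOperator φ T) : 0 < essentialNorm T := by
  obtain ⟨C, hC0, hC⟩ := exists_norm_scaledEval_le μ
  obtain ⟨c, hc0, hc⟩ := exists_le_norm_scaledEval hφ hm hT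
  refine (div_pos hc0 hC0).trans_le ?_
  -- Nonemptiness matters: `Metric.infDist` to the empty set is `0` by default.
  refine (Metric.le_infDist ⟨0, isCompactOperator_zero⟩).2 fun Q hQ => ?_
  rw [dist_eq_norm, div_le_iff₀' hC0]
  exact le_mul_norm_sub_of_isCompactOperator hC0.le hC (tendsto_norm_scaledEval hL) hc hQ

theorem mainTheorem2 (μ : Measure ℝ≥0) [IsZenMeasure μ] (hL : LaplaceSurjective μ)
    (φ : ℂ → ℂ) (hφ : DifferentiableOn ℂ φ rightHalfPlane)
    (hφ_maps : Set.MapsTo φ rightHalfPlane rightHalfPlane) :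
    (∀ T : ZenSpace μ →ₗ[ℂ] ZenSpace μ, IsCompositionOperator φ T → ¬ IsCompactOperator T) ∧
    (∀ T : ZenSpace μ →L[ℂ] ZenSpace μ, IsCompositionOperator φ T → 0 < essentialNorm T) := by
  refine ⟨fun T hT hcomp => ?_, fun T hT => hT.essentialNorm_pos hL hφ hφ_maps⟩
  -- A compact linear map is continuous, so `T` has an essential norm, which would be zero.
  let S : ZenSpace μ →L[ℂ] ZenSpace μ := ⟨T, hcomp.continuous⟩
  have hS : IsCompositionOperator φ S := hT
  refine (hS.essentialNorm_pos hL hφ hφ_maps).ne' ?_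
  exact Metric.infDist_zero_of_mem (show IsCompactOperator S from hcomp)
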